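/- **Theorem (Upper (inner) approximations of the value functions).** Let $n,m,T\in\mathbb N$, let $\mathbb V$ (switching controls) and $I$ be nonempty finite sets. For $0\le t<T$ and $v\in\mathbb V$ let $A_t^v\in\mathbb R^{n\times n}$, $B_t^v\in\mathbb R^{n\times m}$, let $C_t^v\in\mathbb R^{n\times n}$ be symmetric positive semidefinite and $D_t^v\in\mathbb R^{m\times m}$ symmetric positive definite, and put $$f_t^v(x,u)=A_t^vx+B_t^vu,\qquad c_t^v(x,u)=x^TC_t^vx+u^TD_t^vu .$$ Let $\psi=\inf_{i\in I}\psi_i$ with $\psi_i(x)=x^TM_ix$, where the $M_i$ are symmetric and $0\preceq M_i\preceq\alpha\,\mathrm{Id}$ for all $i\in I$ and some $\alpha\ge 0$. The value functions are defined by $V_T=\psi$ and $V_t(x)=\inf_{v\in\mathbb V}\inf_{u\in\mathbb R^m} c_t^v(x,u)+V_{t+1}(f_t^v(x,u))$ for $0\le t<T$. For $\phi:\mathbb R^n\to\overline{\mathbb R}$ let $$\mathcal B_t^v(\phi)(x)=\inf_{u\in\mathbb R^m}\ c_t^v(x,u)+\|f_t^v(x,u)\|^2\,\phi\!\left(\frac{f_t^v(x,u)}{\|f_t^v(x,u)\|}\right),$$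 where the second summand is read as $0$ if $f_t^v(x,u)=0$. A basic function is a convex pure quadratic form $x\mapsto x^TMx$, $M\succeq 0$ symmetric. A *min-plus selection function* $\sigma_t$ assigns to a set $F$ of basic functions and a point $x\in\mathbb R^n$ a function $\sigma_t(F,x)$ such that, for $t<T$ and $F$ finite and nonempty, $\sigma_t(F,x)=\mathcal B_t^v(\phi)$ for some $(v,\phi)\in\arg\min_{(w,\chi)\in\mathbb V\times F}\mathcal B_t^w(\chi)(x)$, and $\sigma_T(F,x)=\psi_i$ for some $i\in\arg\min_{j\in I}\psi_j(x)$. Fix such selection functions. Let $(x_t^k)_{0\le t\le T}$, $k\in\mathbb N$, be random tuples of points of the Euclidean unit sphere $\mathbf S\subset\mathbb R^n$ that are independent for different $k$ and such that each $x_t^k$ is uniformly distributed on $\mathbf S$. Tropical Dynamic Programming generates sets by $F_t^0=\emptyset$ and, for $k\ge1$, $$F_T^k=F_T^{k-1}\cup\{\sigma_T(F_T^{k-1},x_T^{k-1})\},\qquad F_t^k=F_t^{k-1}\cup\{\sigma_t(F_{t+1}^k,x_t^{k-1})\}\quad (t=T-1,\dots,0),$$ and $V_t^k=\inf_{\phi\in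 F_t^k}\phi$ (so $V_t^0=+\infty$). Then, for every $t\in\{0,\dots,T\}$ and every realization of the draws, the sequence $(V_t^k)_{k\in\mathbb N}$ is nonincreasing, is bounded from below by $V_t$, is finite everywhere for $k\ge 1$, and converges pointwise on $\mathbb R^n$ and uniformly on $\mathbf S$ to a real-valued function $V_t^*$. Moreover, almost surely over the draws, for every $t\in\{0,\dots,T\}$, $V_t^*=V_t$ on $\mathbf S$, and hence on all of $\mathbb R^n$. -/

import Mathlib

open MeasureTheory ProbabilityTheory Filter Topology

/-- The Euclidean space `ℝⁿ`. -/
abbrev Euc (n : ℕ) : Type := EuclideanSpace ℝ (Fin n)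

/-- The pure quadratic form `x ↦ xᵀ M x`. -/
noncomputable def pureQuad {n : ℕ} (M : Matrix (Fin n) (Fin n) ℝ) (x : Euc n) : ℝ :=
  x.ofLp ⬝ᵥ M.mulVec x.ofLp

/-- The data of a switched linear-quadratic problem with state space `ℝⁿ`, continuous control space
`ℝᵐ`, horizon `T`, set `V` of switching controls, and a final cost given by the family of pure
quadratic forms with matrices `M i`, `i : I`. -/
structure SwitchedLQ (n m T : ℕ) (V I : Type*) where
  A : Fin T → V → Matrix (Fin n) (Fin n) ℝ
  B : Fin T → V → Matrix (Fin n) (Fin m) ℝ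
  C : Fin T → V → Matrix (Fin n) (Fin n) ℝ
  D : Fin T → V → Matrix (Fin m) (Fin m) ℝ
  M : I → Matrix (Fin n) (Fin n) ℝ

namespace SwitchedLQ

variable {n m T : ℕ} {V I : Type*}

/-- The standing assumptions: `C` is positive semidefinite and `D` positive definite (both include
symmetry), and `0 ⪯ M i ⪯ α Id` in the Loewner order for all `i` and a common `α ≥ 0`. -/
structure IsAdmissible (p : SwitchedLQ n m T V I) : Prop where
  posSemidef_C : ∀ t v, (p.C t v).PosSemidef
  posDef_D : ∀ t v, (p.D t v).PosDef
  bounded_M : ∃ α : ℝ, 0 ≤ α ∧ ∀ i,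
    (p.M i).PosSemidef ∧ (α • (1 : Matrix (Fin n) (Fin n) ℝ) - p.M i).PosSemidef

/-- The linear dynamics `f_t^v(x, u) = A x + B u`. -/
noncomputable def dyn (p : SwitchedLQ n m T V I) (t : Fin T) (v : V) (x : Euc n) (u : Euc m) :
    Euc n :=
  WithLp.toLp 2 ((p.A t v).mulVec x.ofLp + (p.B t v).mulVec u.ofLp)

/-- The stage cost `c_t^v(x, u) = xᵀ C x + uᵀ D u`. -/
noncomputable def cost (p : SwitchedLQ n m T V I) (t : Fin T) (v : V) (x : Euc n) (u : Euc m) : ℝ :=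
  pureQuad (p.C t v) x + pureQuad (p.D t v) u

/-- The forms `ψ_i(x) = xᵀ M_i x`. -/
noncomputable def finalForm (p : SwitchedLQ n m T V I) (i : I) : Euc n → EReal :=
  fun x => (pureQuad (p.M i) x : EReal)

/-- The final cost `ψ = inf_i ψ_i`. -/
noncomputable def finalCost (p : SwitchedLQ n m T V I) : Euc n → EReal :=
  fun x => ⨅ i, p.finalForm i x

/-- The value functions, i.e. the solution of the dynamic programming equation
`V_T = ψ`, `V_t(x) = inf_v inf_u c_t^v(x, u) + V_{t+1}(f_t^v(x, u))`. -/
noncomputable def value (p : SwitchedLQ n m T V I) (t : Fin (T + 1)) : Euc n → EReal :=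
  Fin.reverseInduction (motive := fun _ => Euc n → EReal)
    p.finalCost
    (fun t W x => ⨅ (v : V) (u : Euc m), (p.cost t v x u : EReal) + W (p.dyn t v x u)) t

theorem value_last (p : SwitchedLQ n m T V I) : p.value (Fin.last T) = p.finalCost := by
  simp [value]

theorem value_castSucc (p : SwitchedLQ n m T V I) (t : Fin T) (x : Euc n) :
    p.value t.castSucc x =
      ⨅ (v : V) (u : Euc m), (p.cost t v x u : EReal) + p.value t.succ (p.dyn t v x u) := by
  simp [value]

/-- The Bellman operator with fixed switching control,
`B_t^v(φ)(x) = inf_u c_t^v(x, u) + ‖f_t^v(x, u)‖² φ(f_t^v(x, u) / ‖f_t^v(x, u)‖)`.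
The second summand is `0` where `f_t^v(x, u) = 0`. -/
noncomputable def bellmanAt (p : SwitchedLQ n m T V I) (t : Fin T) (v : V) (φ : Euc n → EReal) :
    Euc n → EReal :=
  fun x => ⨅ u : Euc m, (p.cost t v x u : EReal) +
    ((‖p.dyn t v x u‖ ^ 2 : ℝ) : EReal) * φ (‖p.dyn t v x u‖⁻¹ • p.dyn t v x u)

end SwitchedLQ

/-- The basic functions: convex pure quadratic forms on `ℝⁿ`. -/
def basicFunctions (n : ℕ) : Set (Euc n → EReal) :=
  {φ | ∃ M : Matrix (Fin n) (Fin n) ℝ, M.PosSemidef ∧ φ = fun x => (pureQuad M x : EReal)}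

/-- `σ t F x` is the function selected at time `t` from the set `F` at the point `x`. For `t < T` it
is `B_t^v(φ)` for some `(v, φ)` that minimizes `B_t^v(φ)(x)` over `V × F`, for all nonempty finite
sets `F` of basic functions; at time `T` it is some `ψ_i` that minimizes `ψ_i(x)`. -/
structure SwitchedLQ.IsMinPlusSelection {n m T : ℕ} {V I : Type*} (p : SwitchedLQ n m T V I)
    (σ : Fin (T + 1) → Set (Euc n → EReal) → Euc n → (Euc n → EReal)) : Prop where
  step : ∀ (t : Fin T) (F : Set (Euc n → EReal)), F ⊆ basicFunctions n → F.Finite → F.Nonempty →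
    ∀ x : Euc n, ∃ v : V, ∃ φ ∈ F,
      (∀ w : V, ∀ χ ∈ F, p.bellmanAt t v φ x ≤ p.bellmanAt t w χ x) ∧
      σ t.castSucc F x = p.bellmanAt t v φ
  final : ∀ F : Set (Euc n → EReal), F ⊆ basicFunctions n →
    ∀ x : Euc n, ∃ i : I,
      (∀ j : I, p.finalForm i x ≤ p.finalForm j x) ∧ σ (Fin.last T) F x = p.finalForm i

/-- One iteration of Tropical Dynamic Programming, with current sets `F` and draws `x`: at time `T`,
add the function selected from `F_T` at `x_T`; then, for `t` from `T - 1` down to `0`, add to `F_t`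
the function selected at `x_t` from the already updated set at time `t + 1`. -/
noncomputable def tdpStep {n T : ℕ}
    (σ : Fin (T + 1) → Set (Euc n → EReal) → Euc n → (Euc n → EReal))
    (F : Fin (T + 1) → Set (Euc n → EReal)) (x : Fin (T + 1) → Euc n) (t : Fin (T + 1)) :
    Set (Euc n → EReal) :=
  Fin.reverseInduction (motive := fun _ => Set (Euc n → EReal))
    (F (Fin.last T) ∪ {σ (Fin.last T) (F (Fin.last T)) (x (Fin.last T))})
    (fun t G => F t.castSucc ∪ {σ t.castSucc G (x t.castSucc)}) t

theorem tdpStep_last {n T : ℕ}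
    (σ : Fin (T + 1) → Set (Euc n → EReal) → Euc n → (Euc n → EReal))
    (F : Fin (T + 1) → Set (Euc n → EReal)) (x : Fin (T + 1) → Euc n) :
    tdpStep σ F x (Fin.last T) =
      F (Fin.last T) ∪ {σ (Fin.last T) (F (Fin.last T)) (x (Fin.last T))} := by
  simp [tdpStep]

theorem tdpStep_castSucc {n T : ℕ}
    (σ : Fin (T + 1) → Set (Euc n → EReal) → Euc n → (Euc n → EReal))
    (F : Fin (T + 1) → Set (Euc n → EReal)) (x : Fin (T + 1) → Euc n) (t : Fin T) :
    tdpStep σ F x t.castSucc =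
      F t.castSucc ∪ {σ t.castSucc (tdpStep σ F x t.succ) (x t.castSucc)} := by
  simp [tdpStep]

/-- The sets `F_t^k` generated by Tropical Dynamic Programming with the draws `x k t`. -/
noncomputable def tdpSets {n T : ℕ}
    (σ : Fin (T + 1) → Set (Euc n → EReal) → Euc n → (Euc n → EReal))
    (x : ℕ → Fin (T + 1) → Euc n) : ℕ → Fin (T + 1) → Set (Euc n → EReal)
  | 0 => fun _ => ∅
  | k + 1 => tdpStep σ (tdpSets σ x k) (x k)

/-- The approximations `V_t^k = inf_{φ ∈ F_t^k} φ`; in particular `V_t^0 = +∞`. -/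
noncomputable def tdpValue {n T : ℕ}
    (σ : Fin (T + 1) → Set (Euc n → EReal) → Euc n → (Euc n → EReal))
    (x : ℕ → Fin (T + 1) → Euc n) (k : ℕ) (t : Fin (T + 1)) : Euc n → EReal :=
  fun y => ⨅ φ ∈ tdpSets σ x k t, φ y

/-- The uniform distribution on the unit sphere of `ℝⁿ`: the normalized surface measure. -/
noncomputable def sphereUniform (n : ℕ) : Measure (Metric.sphere (0 : Euc n) 1) :=
  ((volume : Measure (Euc n)).toSphere Set.univ)⁻¹ • (volume : Measure (Euc n)).toSphere

/-! Riccati's formula shows that the Bellman operators preserve convex quadratic forms, so each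
`V_t^k` with `k ≥ 1` is a finite minimum of such forms. Bounding these forms by `K_t ‖·‖²`, with
`K_t` independent of draws and iterations, gives all `V_t^k` a common modulus of continuity
(`pureQuad_le_add`, `exists_real_tdpValue`). The sequence decreases and is nonnegative, hence
converges; the limit inherits the modulus, and Dini's theorem gives uniformity on the sphere.
Monotonicity of the Bellman operators gives `V_t ≤ V_t^k`.

For equality, optimality of the selection at the draw gives `V_t^{k+1}(x_t^k) ≤ c(x_t^k, u) +
V_{t+1}^{k+1}(f(x_t^k, u))` for all `v`, `u`. Where the draws accumulate, equicontinuity carries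
this to the limits, and homogeneity extends it from the sphere to the whole space. Backward
induction then yields `V_t^* ≤ V_t` (`limit_eq_value`). The only probabilistic input is that the
draws almost surely accumulate everywhere, by the second Borel–Cantelli lemma
(`ae_forall_mapClusterPt`). -/

/-! ### Quadratic forms and their modulus of continuity -/

section QuadraticForms

variable {n m : ℕ}

theorem pureQuad_nonneg {M : Matrix (Fin n) (Fin n) ℝ} (hM : M.PosSemidef) (x : Euc n) :
    0 ≤ pureQuad M x := by
  simpa [pureQuad] using hM.dotProduct_mulVec_nonneg x.ofLp

theorem pureQuad_smul (M : Matrix (Fin n) (Fin n) ℝ) (r : ℝ) (x : Euc n) :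
    pureQuad M (r • x) = r ^ 2 * pureQuad M x := by
  simp [pureQuad, Matrix.mulVec_smul]
  ring

theorem pureQuad_zero (M : Matrix (Fin n) (Fin n) ℝ) : pureQuad M (0 : Euc n) = 0 := by
  simp [pureQuad]

theorem pureQuad_one (x : Euc n) : pureQuad (1 : Matrix (Fin n) (Fin n) ℝ) x = ‖x‖ ^ 2 := by
  simp [pureQuad, dotProduct, EuclideanSpace.norm_sq_eq, ← pow_two]

theorem norm_sq_mul_pureQuad_normalize (M : Matrix (Fin n) (Fin n) ℝ) (x : Euc n) :
    ‖x‖ ^ 2 * pureQuad M (‖x‖⁻¹ • x) = pureQuad M x := by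
  rcases eq_or_ne x 0 with rfl | hx
  · simp [pureQuad_zero]
  · rw [pureQuad_smul]
    field_simp [norm_ne_zero_iff.mpr hx]

theorem continuous_pureQuad (M : Matrix (Fin n) (Fin n) ℝ) :
    Continuous (pureQuad M : Euc n → ℝ) := by
  unfold pureQuad dotProduct Matrix.mulVec dotProduct
  fun_prop

/-- A pure quadratic form is bounded by a multiple of the squared norm. -/
theorem exists_pureQuad_le (M : Matrix (Fin n) (Fin n) ℝ) :
    ∃ K : ℝ, 0 ≤ K ∧ ∀ x : Euc n, pureQuad M x ≤ K * ‖x‖ ^ 2 := by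
  obtain ⟨K, hK⟩ := (isCompact_sphere (0 : Euc n) 1).exists_bound_of_continuousOn
    (continuous_pureQuad M).continuousOn
  refine ⟨|K|, abs_nonneg K, fun x => ?_⟩
  rcases eq_or_ne x 0 with rfl | hx
  · simp [pureQuad_zero]
  · have h := hK (‖x‖⁻¹ • x) (by simp [norm_smul, norm_ne_zero_iff.mpr hx])
    rw [← norm_sq_mul_pureQuad_normalize M x, mul_comm]
    gcongr
    exact (le_abs_self _).trans (h.trans (le_abs_self K))

/-- Cauchy-Schwarz for a positive semidefinite form `≤ K ‖·‖²`, as a modulus of continuity. -/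
theorem pureQuad_le_add {M : Matrix (Fin n) (Fin n) ℝ} (hM : M.PosSemidef) {K : ℝ}
    (hK : ∀ x : Euc n, pureQuad M x ≤ K * ‖x‖ ^ 2) (x y : Euc n) :
    pureQuad M x ≤ pureQuad M y + |K| * (‖x - y‖ * ‖x + y‖) := by
  have hsymm : ∀ a b : Euc n, a.ofLp ⬝ᵥ M.mulVec b.ofLp = b.ofLp ⬝ᵥ M.mulVec a.ofLp := by
    intro a b
    rw [Matrix.dotProduct_mulVec, dotProduct_comm, ← Matrix.mulVec_transpose]
    congr 2
    exact hM.1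
  have hdiff : pureQuad M x - pureQuad M y = (x - y).ofLp ⬝ᵥ M.mulVec (x + y).ofLp := by
    simp only [pureQuad, WithLp.ofLp_sub, WithLp.ofLp_add, Matrix.mulVec_add, sub_dotProduct,
      dotProduct_add]
    linarith [hsymm x y]
  set a := x - y
  set b := x + y
  -- Cauchy–Schwarz: `s ↦ pureQuad M (s • a + b)` is a nonnegative quadratic polynomial.
  have hdisc : discrim (pureQuad M a) (2 * (a.ofLp ⬝ᵥ M.mulVec b.ofLp)) (pureQuad M b) ≤ 0 := by
    refine discrim_le_zero fun s => ?_
    have h := pureQuad_nonneg hM (s • a + b)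
    have e : pureQuad M (s • a + b) = pureQuad M a * (s * s) +
        2 * (a.ofLp ⬝ᵥ M.mulVec b.ofLp) * s + pureQuad M b := by
      simp only [pureQuad, WithLp.ofLp_smul, WithLp.ofLp_add, Matrix.mulVec_add, add_dotProduct,
        dotProduct_add, Matrix.mulVec_smul, smul_dotProduct, dotProduct_smul, smul_eq_mul]
      rw [hsymm b a]
      ring
    linarith
  have hprod : pureQuad M a * pureQuad M b ≤ (K * ‖a‖ ^ 2) * (K * ‖b‖ ^ 2) :=
    mul_le_mul (hK a) (hK b) (pureQuad_nonneg hM b) ((pureQuad_nonneg hM a).trans (hK a))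
  have hsq : (a.ofLp ⬝ᵥ M.mulVec b.ofLp) ^ 2 ≤ (|K| * (‖a‖ * ‖b‖)) ^ 2 := by
    rw [mul_pow, sq_abs]
    unfold discrim at hdisc
    nlinarith
  linarith [abs_le_of_sq_le_sq hsq (by positivity), le_abs_self (a.ofLp ⬝ᵥ M.mulVec b.ofLp)]

end QuadraticForms

/-! ### The Riccati step and bounds for the Bellman operators -/

namespace SwitchedLQ

variable {n m T : ℕ} {V I : Type*} {p : SwitchedLQ n m T V I}

/-- The Riccati step: partial minimization of the quadratic cost over the control gives a
positive semidefinite form, and the minimum is attained. -/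
theorem IsAdmissible.exists_riccati (hp : p.IsAdmissible) (t : Fin T) (v : V)
    {M : Matrix (Fin n) (Fin n) ℝ} (hM : M.PosSemidef) :
    ∃ R : Matrix (Fin n) (Fin n) ℝ, R.PosSemidef ∧
      (∀ x u, pureQuad R x ≤ p.cost t v x u + pureQuad M (p.dyn t v x u)) ∧
      ∀ x, ∃ u, pureQuad R x = p.cost t v x u + pureQuad M (p.dyn t v x u) := by
  set A := p.A t v with hA
  set B := p.B t v with hB
  set Q := p.C t v + A.conjTranspose * M * A
  set S := A.conjTranspose * M * B
  set D := p.D t v + B.conjTranspose * M * B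
  have hD : D.PosDef := (hp.posDef_D t v).add_posSemidef (hM.conjTranspose_mul_mul_same B)
  have hQ : Q.IsHermitian :=
    ((hp.posSemidef_C t v).add (hM.conjTranspose_mul_mul_same A)).1
  let _ := hD.isUnit.invertible
  -- Completing the square in `u`; the local `D`, which includes `BᵀMB`, is positive definite. The
  -- Schur complement is the value at `u = -D⁻¹Sᵀx`, hence nonnegative.
  have key : ∀ (x : Euc n) (u : Euc m), p.cost t v x u + pureQuad M (p.dyn t v x u) =
      pureQuad D (WithLp.toLp 2 ((D⁻¹ * S.conjTranspose).mulVec x.ofLp + u.ofLp)) +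
        pureQuad (Q - S * D⁻¹ * S.conjTranspose) x := by
    intro x u
    have h := Matrix.schur_complement_eq₂₂ Q S x.ofLp u.ofLp hD.1
    simp only [star_trivial, ← Matrix.dotProduct_mulVec] at h
    simp only [pureQuad]
    rw [← h]
    have hMt : M.transpose = M := hM.1
    have hS : S.conjTranspose = B.transpose * M * A := by
      simp [S, Matrix.mul_assoc, hMt]
    have hadj : ∀ {k l : ℕ} (P : Matrix (Fin k) (Fin l) ℝ) (a : Fin l → ℝ) (w : Fin k → ℝ),
        P.mulVec a ⬝ᵥ w = a ⬝ᵥ P.transpose.mulVec w := fun P a w => by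
      rw [Matrix.mulVec_transpose, dotProduct_comm, Matrix.dotProduct_mulVec, dotProduct_comm]
    rw [hS]
    simp only [cost, pureQuad, dyn, ← hA, ← hB, Matrix.fromBlocks_mulVec,
      Sum.elim_comp_inl, Sum.elim_comp_inr, sumElim_dotProduct_sumElim, Q, S, D, Matrix.add_mulVec,
      Matrix.mulVec_add, dotProduct_add, add_dotProduct, ← Matrix.mulVec_mulVec,
      Matrix.conjTranspose_eq_transpose_of_trivial, hadj]
    ring
  have hmin : ∀ x : Euc n, ∃ u,
      pureQuad (Q - S * D⁻¹ * S.conjTranspose) x =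
        p.cost t v x u + pureQuad M (p.dyn t v x u) := by
    intro x
    refine ⟨WithLp.toLp 2 (-((D⁻¹ * S.conjTranspose).mulVec x.ofLp)), ?_⟩
    rw [key]
    simp [pureQuad]
  refine ⟨Q - S * D⁻¹ * S.conjTranspose, ?_, fun x u => ?_, hmin⟩
  · refine .of_dotProduct_mulVec_nonneg ?_ fun x => ?_
    · exact hQ.sub (Matrix.isHermitian_mul_mul_conjTranspose S hD.1.inv)
    · obtain ⟨u, hu⟩ := hmin (WithLp.toLp 2 x)
      have h1 := pureQuad_nonneg (hp.posSemidef_C t v) (WithLp.toLp 2 x)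
      have h2 := pureQuad_nonneg (hp.posDef_D t v).posSemidef u
      have h3 := pureQuad_nonneg hM (p.dyn t v (WithLp.toLp 2 x) u)
      have : 0 ≤ pureQuad (Q - S * D⁻¹ * S.conjTranspose) (WithLp.toLp 2 x) := by
        rw [hu, cost]; positivity
      simpa [pureQuad] using this
  · rw [key]
    linarith [pureQuad_nonneg hD.posSemidef
      (WithLp.toLp 2 ((D⁻¹ * S.conjTranspose).mulVec x.ofLp + u.ofLp))]

/-- Homogeneity of degree two undoes the normalization, also where the dynamics vanish, so on forms
this is the usual dynamic programming operator. -/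
theorem bellmanAt_pureQuad (p : SwitchedLQ n m T V I) (t : Fin T) (v : V)
    (M : Matrix (Fin n) (Fin n) ℝ) (x : Euc n) :
    p.bellmanAt t v (fun y => (pureQuad M y : EReal)) x =
      ⨅ u : Euc m, ((p.cost t v x u + pureQuad M (p.dyn t v x u) : ℝ) : EReal) := by
  unfold bellmanAt
  refine iInf_congr fun u => ?_
  rw [← EReal.coe_mul, norm_sq_mul_pureQuad_normalize, EReal.coe_add]

end SwitchedLQ

/-- The convex pure quadratic forms bounded above by `K ‖·‖²`. -/
def boundedForms (n : ℕ) (K : ℝ) : Set (Euc n → EReal) :=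
  {φ | ∃ M : Matrix (Fin n) (Fin n) ℝ, M.PosSemidef ∧ (∀ x : Euc n, pureQuad M x ≤ K * ‖x‖ ^ 2) ∧
    φ = fun x => (pureQuad M x : EReal)}

theorem boundedForms_subset_basicFunctions (n : ℕ) (K : ℝ) :
    boundedForms n K ⊆ basicFunctions n := by
  rintro φ ⟨M, hM, -, rfl⟩
  exact ⟨M, hM, rfl⟩

namespace SwitchedLQ

variable {n m T : ℕ} {V I : Type*} {p : SwitchedLQ n m T V I}

theorem dyn_zero_right (p : SwitchedLQ n m T V I) (t : Fin T) (v : V) (x : Euc n) :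
    p.dyn t v x 0 = WithLp.toLp 2 ((p.A t v).mulVec x.ofLp) := by
  simp [dyn]

theorem continuous_cost_left (p : SwitchedLQ n m T V I) (t : Fin T) (v : V) (u : Euc m) :
    Continuous fun x => p.cost t v x u :=
  (continuous_pureQuad _).add continuous_const

theorem continuous_dyn_left (p : SwitchedLQ n m T V I) (t : Fin T) (v : V) (u : Euc m) :
    Continuous fun x => p.dyn t v x u := by
  unfold dyn Matrix.mulVec dotProduct
  fun_prop

/-- The Bellman operator maps basic functions to basic functions. -/
theorem IsAdmissible.exists_bellmanAt_eq (hp : p.IsAdmissible) (t : Fin T) (v : V)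
    {M : Matrix (Fin n) (Fin n) ℝ} (hM : M.PosSemidef) :
    ∃ R : Matrix (Fin n) (Fin n) ℝ, R.PosSemidef ∧
      (∀ x u, pureQuad R x ≤ p.cost t v x u + pureQuad M (p.dyn t v x u)) ∧
      p.bellmanAt t v (fun y => (pureQuad M y : EReal)) = fun x => (pureQuad R x : EReal) := by
  obtain ⟨R, hR, hle, hmin⟩ := hp.exists_riccati t v hM
  refine ⟨R, hR, hle, funext fun x => ?_⟩
  rw [bellmanAt_pureQuad]
  refine le_antisymm ?_ (le_iInf fun u => EReal.coe_le_coe (hle x u))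
  obtain ⟨u, hu⟩ := hmin x
  exact (iInf_le _ u).trans_eq (by rw [hu])

/-- The Bellman operators map uniformly bounded families of forms to such families. -/
theorem IsAdmissible.exists_bellmanAt_mem_boundedForms [Finite V] (hp : p.IsAdmissible) (t : Fin T)
    (K : ℝ) :
    ∃ K', ∀ v, ∀ φ ∈ boundedForms n K, p.bellmanAt t v φ ∈ boundedForms n K' := by
  have h : ∀ v, ∃ K', ∀ φ ∈ boundedForms n K, p.bellmanAt t v φ ∈ boundedForms n K' := by
    intro v
    obtain ⟨a, -, hC⟩ := exists_pureQuad_le (p.C t v)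
    obtain ⟨b, -, hA⟩ := exists_pureQuad_le ((p.A t v).transpose * p.A t v)
    -- The bound obtained from the control `u = 0`.
    refine ⟨a + |K| * b, ?_⟩
    rintro φ ⟨M, hM, hK, rfl⟩
    obtain ⟨R, hR, hle, heq⟩ := hp.exists_bellmanAt_eq t v hM
    refine ⟨R, hR, fun x => (hle x 0).trans ?_, heq⟩
    have hA' : ‖p.dyn t v x 0‖ ^ 2 ≤ b * ‖x‖ ^ 2 := by
      refine le_trans (le_of_eq ?_) (hA x)
      rw [← pureQuad_one, dyn_zero_right]
      simp only [pureQuad, Matrix.one_mulVec, ← Matrix.mulVec_mulVec, Matrix.mulVec_transpose]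
      rw [dotProduct_comm x.ofLp, ← Matrix.dotProduct_mulVec]
    have h1 : pureQuad M (p.dyn t v x 0) ≤ |K| * (b * ‖x‖ ^ 2) := by
      refine (hK _).trans ?_
      exact mul_le_mul (le_abs_self K) hA' (by positivity) (abs_nonneg K)
    have h2 := hC x
    rw [cost, pureQuad_zero]
    linarith
  choose K' hK' using h
  obtain ⟨L, hL⟩ := (Set.finite_range K').bddAbove
  refine ⟨L, fun v φ hφ => ?_⟩
  obtain ⟨M, hM, hle, heq⟩ := hK' v φ hφ
  refine ⟨M, hM, fun x => (hle x).trans ?_, heq⟩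
  have := hL ⟨v, rfl⟩
  gcongr

theorem IsAdmissible.exists_finalForm_mem_boundedForms (hp : p.IsAdmissible) :
    ∃ K, ∀ i, p.finalForm i ∈ boundedForms n K := by
  obtain ⟨α, -, hα⟩ := hp.bounded_M
  refine ⟨α, fun i => ⟨p.M i, (hα i).1, fun x => ?_, rfl⟩⟩
  have h := pureQuad_nonneg (hα i).2 x
  have h1 := pureQuad_one x
  simp only [pureQuad, Matrix.sub_mulVec, dotProduct_sub, Matrix.smul_mulVec,
    dotProduct_smul, smul_eq_mul] at h h1 ⊢
  rw [h1] at h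
  linarith

end SwitchedLQ

/-! ### Monotonicity and finiteness of the generated sets -/

section Generated

variable {n T : ℕ} (σ : Fin (T + 1) → Set (Euc n → EReal) → Euc n → (Euc n → EReal))
  (x : ℕ → Fin (T + 1) → Euc n)

theorem tdpSets_succ_last (k : ℕ) :
    tdpSets σ x (k + 1) (Fin.last T) = tdpSets σ x k (Fin.last T) ∪
      {σ (Fin.last T) (tdpSets σ x k (Fin.last T)) (x k (Fin.last T))} :=
  tdpStep_last σ _ _

theorem tdpSets_succ_castSucc (k : ℕ) (t : Fin T) :
    tdpSets σ x (k + 1) t.castSucc = tdpSets σ x k t.castSucc ∪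
      {σ t.castSucc (tdpSets σ x (k + 1) t.succ) (x k t.castSucc)} :=
  tdpStep_castSucc σ _ _ t

theorem tdpSets_subset_succ (k : ℕ) (t : Fin (T + 1)) :
    tdpSets σ x k t ⊆ tdpSets σ x (k + 1) t := by
  induction t using Fin.lastCases with
  | last => rw [tdpSets_succ_last]; exact Set.subset_union_left
  | cast t => rw [tdpSets_succ_castSucc]; exact Set.subset_union_left

theorem tdpSets_succ_nonempty (k : ℕ) (t : Fin (T + 1)) : (tdpSets σ x (k + 1) t).Nonempty := by
  induction t using Fin.lastCases with
  | last => rw [tdpSets_succ_last]; exact ⟨_, Or.inr rfl⟩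
  | cast t => rw [tdpSets_succ_castSucc]; exact ⟨_, Or.inr rfl⟩

theorem tdpSets_finite (k : ℕ) (t : Fin (T + 1)) : (tdpSets σ x k t).Finite := by
  induction k with
  | zero => exact Set.finite_empty
  | succ k ih =>
    induction t using Fin.lastCases with
    | last => rw [tdpSets_succ_last]; exact ih.union (Set.finite_singleton _)
    | cast t => rw [tdpSets_succ_castSucc]; exact ih.union (Set.finite_singleton _)

theorem tdpValue_antitone (t : Fin (T + 1)) : Antitone fun k => tdpValue σ x k t :=
  antitone_nat_of_succ_le fun k _ =>
    biInf_mono fun _ h => tdpSets_subset_succ σ x k t h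

/-- The infimum defining `V_t^k`, `k ≥ 1`, is attained. -/
theorem exists_mem_tdpValue_succ_eq (k : ℕ) (t : Fin (T + 1)) (y : Euc n) :
    ∃ φ ∈ tdpSets σ x (k + 1) t, tdpValue σ x (k + 1) t y = φ y := by
  obtain ⟨φ, hφ, hmin⟩ := Set.exists_min_image _ (fun φ => φ y) (tdpSets_finite σ x (k + 1) t)
    (tdpSets_succ_nonempty σ x k t)
  exact ⟨φ, hφ, le_antisymm (iInf₂_le φ hφ) (le_iInf₂ hmin)⟩

end Generated

/-! ### Uniform bounds and the lower bound by the value function -/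

namespace SwitchedLQ.IsMinPlusSelection

variable {n m T : ℕ} {V I : Type*} {p : SwitchedLQ n m T V I}
  {σ : Fin (T + 1) → Set (Euc n → EReal) → Euc n → (Euc n → EReal)}

/-- All functions generated at time `t` belong to a common bounded family of forms. -/
theorem exists_tdpSets_subset [Finite V] (hσ : p.IsMinPlusSelection σ) (hp : p.IsAdmissible)
    (t : Fin (T + 1)) :
    ∃ K, ∀ x k, tdpSets σ x k t ⊆ boundedForms n K := by
  -- Backward induction fixes the constant before draws and iterations enter; the inner induction on
  -- `k` keeps it.
  induction t using Fin.reverseInduction with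
  | last =>
    obtain ⟨K, hK⟩ := hp.exists_finalForm_mem_boundedForms
    refine ⟨K, fun x k => ?_⟩
    induction k with
    | zero => exact Set.empty_subset _
    | succ k ih =>
      rw [tdpSets_succ_last]
      refine Set.union_subset ih (Set.singleton_subset_iff.2 ?_)
      obtain ⟨i, -, hi⟩ := hσ.final _ (ih.trans (boundedForms_subset_basicFunctions n K))
        (x k (Fin.last T))
      exact hi ▸ hK i
  | cast t iht =>
    obtain ⟨K, hK⟩ := iht
    obtain ⟨K', hK'⟩ := hp.exists_bellmanAt_mem_boundedForms t K
    refine ⟨K', fun x k => ?_⟩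
    induction k with
    | zero => exact Set.empty_subset _
    | succ k ih =>
      rw [tdpSets_succ_castSucc]
      refine Set.union_subset ih (Set.singleton_subset_iff.2 ?_)
      obtain ⟨v, φ, hφ, -, h⟩ := hσ.step t _
        ((hK x (k + 1)).trans (boundedForms_subset_basicFunctions n K))
        (tdpSets_finite σ x (k + 1) _) (tdpSets_succ_nonempty σ x k _) (x k t.castSucc)
      exact h ▸ hK' v φ (hK x (k + 1) hφ)

/-- The form selected at time `t < T` at the draw is optimal there. -/
theorem exists_selected [Finite V] (hσ : p.IsMinPlusSelection σ) (hp : p.IsAdmissible)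
    (x : ℕ → Fin (T + 1) → Euc n) (k : ℕ) (t : Fin T) :
    ∃ v, ∃ φ ∈ tdpSets σ x (k + 1) t.succ,
      (∀ w, ∀ χ ∈ tdpSets σ x (k + 1) t.succ,
        p.bellmanAt t v φ (x k t.castSucc) ≤ p.bellmanAt t w χ (x k t.castSucc)) ∧
      σ t.castSucc (tdpSets σ x (k + 1) t.succ) (x k t.castSucc) = p.bellmanAt t v φ := by
  obtain ⟨K, hK⟩ := hσ.exists_tdpSets_subset hp t.succ
  exact hσ.step t _ ((hK x (k + 1)).trans (boundedForms_subset_basicFunctions n K))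
    (tdpSets_finite σ x (k + 1) _) (tdpSets_succ_nonempty σ x k _) _

theorem exists_selected_last [Finite V] (hσ : p.IsMinPlusSelection σ) (hp : p.IsAdmissible)
    (x : ℕ → Fin (T + 1) → Euc n) (k : ℕ) :
    ∃ i, (∀ j, p.finalForm i (x k (Fin.last T)) ≤ p.finalForm j (x k (Fin.last T))) ∧
      σ (Fin.last T) (tdpSets σ x k (Fin.last T)) (x k (Fin.last T)) = p.finalForm i := by
  obtain ⟨K, hK⟩ := hσ.exists_tdpSets_subset hp (Fin.last T)
  exact hσ.final _ ((hK x k).trans (boundedForms_subset_basicFunctions n K)) _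

/-- Every generated function is an upper bound of the value function. -/
theorem value_le_of_mem [Finite V] (hσ : p.IsMinPlusSelection σ) (hp : p.IsAdmissible)
    (x : ℕ → Fin (T + 1) → Euc n) (t : Fin (T + 1)) (k : ℕ) :
    ∀ φ ∈ tdpSets σ x k t, p.value t ≤ φ := by
  induction t using Fin.reverseInduction generalizing k with
  | last =>
    induction k with
    | zero => exact fun φ hφ => hφ.elim
    | succ k ih =>
      rw [tdpSets_succ_last]
      rintro φ (hφ | rfl)
      · exact ih φ hφ
      · obtain ⟨i, -, hi⟩ := hσ.exists_selected_last hp x k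
        rw [hi, value_last]
        exact fun y => iInf_le _ i
  | cast t iht =>
    induction k with
    | zero => exact fun φ hφ => hφ.elim
    | succ k ih =>
      rw [tdpSets_succ_castSucc]
      rintro φ (hφ | rfl)
      · exact ih φ hφ
      · obtain ⟨v, χ, hχ, -, h⟩ := hσ.exists_selected hp x k t
        rw [h]
        intro y
        obtain ⟨K, hK⟩ := hσ.exists_tdpSets_subset hp t.succ
        have hle := iht (k + 1) χ hχ
        obtain ⟨M, hM, -, rfl⟩ := hK x (k + 1) hχ
        rw [value_castSucc, bellmanAt_pureQuad]
        refine le_iInf fun u => (iInf₂_le v u).trans ?_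
        rw [EReal.coe_add]
        gcongr
        exact hle _

theorem value_le_tdpValue [Finite V] (hσ : p.IsMinPlusSelection σ) (hp : p.IsAdmissible)
    (x : ℕ → Fin (T + 1) → Euc n) (t : Fin (T + 1)) (k : ℕ) :
    p.value t ≤ tdpValue σ x k t :=
  fun y => le_iInf₂ fun φ hφ => hσ.value_le_of_mem hp x t k φ hφ y

end SwitchedLQ.IsMinPlusSelection

/-- A limit of one-sided estimates along points that accumulate at `y`. -/
theorem MapClusterPt.le_of_forall_le_add {E : Type*} [TopologicalSpace E] {y : E} {z : ℕ → E}
    (hz : MapClusterPt y atTop z) {h : E → ℝ} (hh : ContinuousAt h y) {a : ℕ → ℝ} {l L : ℝ}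
    (ha : Tendsto a atTop (𝓝 l)) (hle : ∀ k, L ≤ h (z k) + a k) : L ≤ h y + l := by
  by_contra! hlt
  obtain ⟨k, hk1, hk2⟩ := ((hz.frequently (hh.eventually_lt_const
    (show h y < h y + (L - (h y + l)) / 2 by linarith))).and_eventually
    (ha.eventually_lt_const (show l < l + (L - (h y + l)) / 2 by linarith))).exists
  linarith [hle k]

/-! ### Convergence and identification of the limit -/

namespace SwitchedLQ.IsMinPlusSelection

variable {n m T : ℕ} {V I : Type*} {p : SwitchedLQ n m T V I}
  {σ : Fin (T + 1) → Set (Euc n → EReal) → Euc n → (Euc n → EReal)}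

/-- The approximations at time `t` are, from the first iteration on, real-valued, nonnegative and
equicontinuous on bounded sets, with a modulus independent of the draws. -/
theorem exists_real_tdpValue [Finite V] (hσ : p.IsMinPlusSelection σ) (hp : p.IsAdmissible)
    (t : Fin (T + 1)) :
    ∃ K : ℝ, 0 ≤ K ∧ ∀ x k, ∃ W : Euc n → ℝ, (∀ y, tdpValue σ x (k + 1) t y = W y) ∧
      (∀ y, 0 ≤ W y) ∧ ∀ y z, W y ≤ W z + K * (‖y - z‖ * ‖y + z‖) := by
  obtain ⟨K, hK⟩ := hσ.exists_tdpSets_subset hp t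
  refine ⟨|K|, abs_nonneg K, fun x k => ?_⟩
  have h : ∀ y, ∃ M : Matrix (Fin n) (Fin n) ℝ, M.PosSemidef ∧
      (∀ x : Euc n, pureQuad M x ≤ K * ‖x‖ ^ 2) ∧
      (fun x => (pureQuad M x : EReal)) ∈ tdpSets σ x (k + 1) t ∧
      tdpValue σ x (k + 1) t y = (pureQuad M y : EReal) := by
    intro y
    obtain ⟨φ, hφ, hy⟩ := exists_mem_tdpValue_succ_eq σ x k t y
    obtain ⟨M, hM, hle, rfl⟩ := hK x (k + 1) hφ
    exact ⟨M, hM, hle, hφ, hy⟩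
  choose M hM hle hmem hval using h
  refine ⟨fun y => pureQuad (M y) y, hval, fun y => pureQuad_nonneg (hM y) y, fun y z => ?_⟩
  -- The form attaining the minimum at `z` is a competitor at `y`.
  refine le_trans ?_ (pureQuad_le_add (hM z) (hle z) y z)
  rw [← EReal.coe_le_coe_iff, ← hval]
  exact iInf₂_le _ (hmem z)

/-- Convergence of the approximations for every sequence of draws. -/
theorem exists_limit [Finite V] (hσ : p.IsMinPlusSelection σ) (hp : p.IsAdmissible)
    (x : ℕ → Fin (T + 1) → Euc n) (t : Fin (T + 1)) :
    ∃ W : Euc n → ℝ,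
      (∀ y, Tendsto (fun k => tdpValue σ x k t y) atTop (𝓝 (W y : EReal))) ∧
      TendstoUniformlyOn (fun k y => (tdpValue σ x k t y).toReal) W atTop
        (Metric.sphere (0 : Euc n) 1) := by
  -- `W k` is the approximation of index `k + 1`, since index `0` gives `⊤`.
  obtain ⟨K, -, h⟩ := hσ.exists_real_tdpValue hp t
  choose W hW hW0 hWK using h x
  have hanti : ∀ y, Antitone fun k => W k y := fun y i j hij => by
    rw [← EReal.coe_le_coe_iff, ← hW, ← hW]
    exact tdpValue_antitone σ x t (Nat.succ_le_succ hij) y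
  have hlim : ∀ y, Tendsto (fun k => W k y) atTop (𝓝 (⨅ k, W k y)) := fun y =>
    tendsto_atTop_ciInf (hanti y) ⟨0, by rintro _ ⟨k, rfl⟩; exact hW0 k y⟩
  have hcont : ∀ f : Euc n → ℝ, (∀ y z, f y ≤ f z + K * (‖y - z‖ * ‖y + z‖)) → Continuous f := by
    intro f hf
    refine continuous_iff_continuousAt.2 fun y => ?_
    have h0 : Tendsto (fun z => K * (‖z - y‖ * ‖z + y‖)) (𝓝 y) (𝓝 0) := by
      have : Continuous fun z => K * (‖z - y‖ * ‖z + y‖) := by fun_prop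
      simpa using this.tendsto y
    refine tendsto_iff_dist_tendsto_zero.2
      (squeeze_zero (fun _ => dist_nonneg) (fun z => ?_) h0)
    have h1 := hf y z
    rw [norm_sub_rev, add_comm y z] at h1
    exact abs_sub_le_iff.2 ⟨by linarith [hf z y], by linarith⟩
  have hWlimK : ∀ y z, (⨅ k, W k y) ≤ (⨅ k, W k z) + K * (‖y - z‖ * ‖y + z‖) := fun y z =>
    le_of_tendsto_of_tendsto' (hlim y) ((hlim z).add_const _) fun k => hWK k y z
  refine ⟨fun y => ⨅ k, W k y, fun y => ?_, ?_⟩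
  · rw [← tendsto_add_atTop_iff_nat 1]
    simp_rw [hW]
    exact (continuous_coe_real_ereal.tendsto _).comp (hlim y)
  -- Dini's theorem, then an index shift; starting at `N + 1` avoids `⊤.toReal = 0`.
  · have hunif := Antitone.tendstoUniformlyOn_of_forall_tendsto (isCompact_sphere (0 : Euc n) 1)
      (fun k => (hcont (W k) (hWK k)).continuousOn) (fun y _ => hanti y)
      (hcont _ hWlimK).continuousOn (fun y _ => hlim y)
    intro u hu
    obtain ⟨N, hN⟩ := eventually_atTop.1 (hunif u hu)
    refine eventually_atTop.2 ⟨N + 1, fun k hk y hy => ?_⟩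
    obtain ⟨k, rfl⟩ := Nat.exists_eq_add_of_le' (Nat.one_le_of_lt hk)
    simpa [hW] using hN k (by omega) y hy

/-- If every point of the sphere is an accumulation point of the draws at each time, then the
limits of the approximations are the value functions. -/
theorem limit_eq_value [Finite V] (hσ : p.IsMinPlusSelection σ)
    (hp : p.IsAdmissible) (x : ℕ → Fin (T + 1) → Euc n)
    (hS : (Metric.sphere (0 : Euc n) 1).Nonempty)
    (hx : ∀ t, ∀ s ∈ Metric.sphere (0 : Euc n) 1, MapClusterPt s atTop fun k => x k t)
    (W : Fin (T + 1) → Euc n → ℝ)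
    (hW : ∀ t y, Tendsto (fun k => tdpValue σ x k t y) atTop (𝓝 (W t y : EReal)))
    (t : Fin (T + 1)) (y : Euc n) : (W t y : EReal) = p.value t y := by
  have hWle : ∀ t k y, (W t y : EReal) ≤ tdpValue σ x k t y := fun t k y =>
    Antitone.le_of_tendsto (fun _ _ hij => tdpValue_antitone σ x t hij y) (hW t y) k
  have hge : ∀ t y, p.value t y ≤ W t y := fun t y =>
    ge_of_tendsto' (hW t y) fun k => hσ.value_le_tdpValue hp x t k y
  -- With `y = r • s` and `s` on the sphere, the draws scaled by `r` accumulate at `y`.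
  have hpolar : ∀ y : Euc n, ∃ r : ℝ, ∀ t, MapClusterPt y atTop fun k => r • x k t := by
    intro y
    obtain ⟨s, hs, r, rfl⟩ : ∃ s ∈ Metric.sphere (0 : Euc n) 1, ∃ r : ℝ, r • s = y := by
      rcases eq_or_ne y 0 with rfl | hy
      · obtain ⟨s, hs⟩ := hS
        exact ⟨s, hs, 0, zero_smul _ _⟩
      · exact ⟨‖y‖⁻¹ • y, by simp [norm_smul, norm_ne_zero_iff.2 hy], ‖y‖,
          smul_inv_smul₀ (norm_ne_zero_iff.2 hy) y⟩
    exact ⟨r, fun t => (hx t s hs).continuousAt_comp (continuous_const_smul r).continuousAt⟩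
  -- an upper bound at the scaled draws is transported to `y`
  have htransport : ∀ t (y : Euc n) (r : ℝ), ∃ e : Euc n → ℝ, Continuous e ∧ e y = 0 ∧
      ∀ k (b : ℝ), (∃ M : Matrix (Fin n) (Fin n) ℝ,
        (fun z => (pureQuad M z : EReal)) ∈ tdpSets σ x (k + 1) t ∧
        pureQuad M (r • x k t) ≤ b) → W t y ≤ b + e (r • x k t) := by
    intro t y r
    obtain ⟨K, hK0, h⟩ := hσ.exists_real_tdpValue hp t
    choose R hR hR0 hRK using h x
    refine ⟨fun z => K * (‖y - z‖ * ‖y + z‖), by fun_prop, by simp, ?_⟩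
    rintro k b ⟨M, hM, hb⟩
    have h1 : W t y ≤ R k y := by
      rw [← EReal.coe_le_coe_iff, ← hR]
      exact hWle t (k + 1) y
    have h2 : R k (r • x k t) ≤ pureQuad M (r • x k t) := by
      rw [← EReal.coe_le_coe_iff, ← hR]
      exact iInf₂_le _ hM
    linarith [hRK k y (r • x k t)]
  refine le_antisymm ?_ (hge t y)
  induction t using Fin.reverseInduction generalizing y with
  | last =>
    rw [value_last]
    refine le_iInf fun j => EReal.coe_le_coe ?_
    obtain ⟨r, hr⟩ := hpolar y
    obtain ⟨e, he, hey, hb⟩ := htransport (Fin.last T) y r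
    have := (hr (Fin.last T)).le_of_forall_le_add (L := W (Fin.last T) y)
      (h := fun z => pureQuad (p.M j) z + e z)
      ((continuous_pureQuad _).add he).continuousAt (tendsto_const_nhds (x := (0 : ℝ)))
      (fun k => by
        rw [add_zero]
        refine hb k _ ?_
        obtain ⟨i, hi, hsel⟩ := hσ.exists_selected_last hp x k
        refine ⟨p.M i, ?_, ?_⟩
        · rw [tdpSets_succ_last, hsel]
          exact Or.inr rfl
        · have := EReal.coe_le_coe_iff.1 (hi j)
          rw [pureQuad_smul, pureQuad_smul]
          gcongr)
    simpa [hey] using this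
  | cast t iht =>
    rw [value_castSucc]
    refine le_iInf₂ fun w u => ?_
    -- By induction it suffices that the limits satisfy `W_t(y) ≤ c(y, u) + W_{t+1}(f(y, u))`.
    refine le_trans ?_ (add_le_add_right (iht (p.dyn t w y u)) _)
    rw [← EReal.coe_add, EReal.coe_le_coe_iff]
    obtain ⟨r, hr⟩ := hpolar y
    obtain ⟨e, he, hey, hb⟩ := htransport t.castSucc y r
    obtain ⟨K', -, h'⟩ := hσ.exists_real_tdpValue hp t.succ
    choose R hR hR0 hRK using h' x
    have hRlim : Tendsto (fun k => R k (p.dyn t w y u)) atTop (𝓝 (W t.succ (p.dyn t w y u))) := by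
      have h := (tendsto_add_atTop_iff_nat 1).2 (hW t.succ (p.dyn t w y u))
      simp_rw [hR] at h
      exact EReal.tendsto_coe.1 h
    have hf := p.continuous_dyn_left t w u
    -- The modulus replaces the moving point `f(z, u)` by the fixed `f(y, u)`, where pointwise
    -- convergence suffices; the error vanishes at `z = y`.
    have := (hr t.castSucc).le_of_forall_le_add (L := W t.castSucc y)
      (h := fun z => p.cost t w z u + K' * (‖p.dyn t w z u - p.dyn t w y u‖ *
        ‖p.dyn t w z u + p.dyn t w y u‖) + e z)
      (((p.continuous_cost_left t w u).add (by fun_prop)).add he).continuousAt hRlim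
      (fun k => by
        set z := r • x k t.castSucc with hz
        refine (hb k (p.cost t w z u + R k (p.dyn t w z u)) ?_).trans
          (by linarith [hRK k (p.dyn t w z u) (p.dyn t w y u)])
        obtain ⟨v, φ, hφ, hmin, hsel⟩ := hσ.exists_selected hp x k t
        obtain ⟨χ, hχ, hRχ⟩ := exists_mem_tdpValue_succ_eq σ x k t.succ (p.dyn t w z u)
        obtain ⟨K, hK⟩ := hσ.exists_tdpSets_subset hp t.succ
        have hmin' := hmin w χ hχ
        obtain ⟨M, hM, -, rfl⟩ := hK x (k + 1) hφ
        obtain ⟨N, hN, -, rfl⟩ := hK x (k + 1) hχ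
        obtain ⟨M', -, -, hM'⟩ := hp.exists_bellmanAt_eq t v hM
        obtain ⟨N', -, hN'le, hN'⟩ := hp.exists_bellmanAt_eq t w hN
        rw [hR, EReal.coe_eq_coe_iff] at hRχ
        refine ⟨M', ?_, ?_⟩
        · rw [tdpSets_succ_castSucc, hsel, hM']
          exact Or.inr rfl
        · rw [hM', hN', EReal.coe_le_coe_iff] at hmin'
          rw [hRχ]
          refine le_trans ?_ (hN'le z u)
          -- Optimality is known at the draw itself; both sides scale by `r ^ 2`.
          rw [hz, pureQuad_smul, pureQuad_smul]
          gcongr)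
    simpa [hey] using this

end SwitchedLQ.IsMinPlusSelection

/-! ### Accumulation of the random draws -/

section Draws

/-- Full support is the only property of the uniform law that is used. The normalizing factor is
nonzero because the surface measure is finite. -/
instance isOpenPosMeasure_sphereUniform (n : ℕ) : (sphereUniform n).IsOpenPosMeasure :=
  Measure.isOpenPosMeasure_smul _ (ENNReal.inv_ne_zero.2 (measure_ne_top _ _))

/-- Almost surely, every point is an accumulation point of independent draws from a common law of
full support. -/
theorem ae_forall_mapClusterPt {Ω S : Type*} [MeasurableSpace Ω] {P : Measure Ω}
    [TopologicalSpace S] [SecondCountableTopology S] [MeasurableSpace S] [OpensMeasurableSpace S]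
    {μ : Measure S} [μ.IsOpenPosMeasure] {Y : ℕ → Ω → S} (hY : ∀ k, Measurable (Y k))
    (hlaw : ∀ k, P.map (Y k) = μ) (hindep : iIndepFun Y P) :
    ∀ᵐ ω ∂P, ∀ s, MapClusterPt s atTop fun k => Y k ω := by
  have := hindep.isProbabilityMeasure
  have hB := TopologicalSpace.isBasis_countableBasis S
  have h : ∀ U ∈ TopologicalSpace.countableBasis S, ∀ᵐ ω ∂P, ∃ᶠ k in atTop, Y k ω ∈ U := by
    intro U hU
    have hUo := hB.isOpen hU
    have hmeas : ∀ k, MeasurableSet (Y k ⁻¹' U) := fun k => hY k hUo.measurableSet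
    have hpos : μ U ≠ 0 :=
      hUo.measure_ne_zero _ (TopologicalSpace.nonempty_of_mem_countableBasis hU)
    -- Second Borel–Cantelli: the events are independent with constant positive probability, so
    -- their probabilities have infinite sum.
    have hlim : P (limsup (fun k => Y k ⁻¹' U) atTop) = 1 := by
      refine measure_limsup_eq_one hmeas ?_ ?_
      · rw [iIndepSet_iff_meas_biInter hmeas]
        exact fun s => hindep.measure_inter_preimage_eq_mul s fun _ _ => hUo.measurableSet
      · have : ∀ k, P (Y k ⁻¹' U) = μ U := fun k => by
          rw [← hlaw k, Measure.map_apply (hY k) hUo.measurableSet]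
        simp_rw [this]
        exact ENNReal.tsum_const_eq_top_of_ne_zero hpos
    have hae := (mem_ae_iff_prob_eq_one (MeasurableSet.measurableSet_limsup hmeas)).2 hlim
    filter_upwards [hae] with ω hω
    exact mem_limsup_iff_frequently_mem.1 hω
  have hall := (ae_ball_iff (TopologicalSpace.countable_countableBasis S)).2 h
  filter_upwards [hall] with ω hω s
  exact hB.nhds_hasBasis.mapClusterPt_iff_frequently.2 fun U hU => hω U hU.1

end Draws

theorem mainTheorem3 {n m T : ℕ} {V I : Type*} [Finite V] [Nonempty V] [Finite I] [Nonempty I]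
    (p : SwitchedLQ n m T V I) (hp : p.IsAdmissible)
    (σ : Fin (T + 1) → Set (Euc n → EReal) → Euc n → (Euc n → EReal))
    (hσ : p.IsMinPlusSelection σ)
    {Ω : Type*} [MeasurableSpace Ω] (P : Measure Ω) [IsProbabilityMeasure P]
    (X : ℕ → Ω → Fin (T + 1) → Metric.sphere (0 : Euc n) 1)
    (hX : ∀ k, Measurable (X k))
    (hlaw : ∀ k t, P.map (fun ω => X k ω t) = sphereUniform n)
    (hindep : iIndepFun X P) :
    ∃ Vstar : Ω → Fin (T + 1) → Euc n → ℝ,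
      (∀ ω t,
        Antitone (fun k => tdpValue σ (fun k t => (X k ω t : Euc n)) k t) ∧
        (∀ k, p.value t ≤ tdpValue σ (fun k t => (X k ω t : Euc n)) k t) ∧
        (∀ k, 1 ≤ k → ∀ x, tdpValue σ (fun k t => (X k ω t : Euc n)) k t x ≠ ⊤ ∧
          tdpValue σ (fun k t => (X k ω t : Euc n)) k t x ≠ ⊥) ∧
        (∀ x, Tendsto (fun k => tdpValue σ (fun k t => (X k ω t : Euc n)) k t x) atTop
          (𝓝 (Vstar ω t x : EReal))) ∧
        TendstoUniformlyOn
          (fun k x => (tdpValue σ (fun k t => (X k ω t : Euc n)) k t x).toReal)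
          (Vstar ω t) atTop (Metric.sphere (0 : Euc n) 1)) ∧
      (∀ᵐ ω ∂P, ∀ t,
        (∀ x ∈ Metric.sphere (0 : Euc n) 1, (Vstar ω t x : EReal) = p.value t x) ∧
        (∀ x, (Vstar ω t x : EReal) = p.value t x)) := by
  choose W hW hWunif using fun ω => hσ.exists_limit hp (fun k t => (X k ω t : Euc n))
  refine ⟨W, fun ω t => ⟨tdpValue_antitone σ _ t, hσ.value_le_tdpValue hp _ t,
    fun k hk y => ?_, hW ω t, hWunif ω t⟩, ?_⟩
  · obtain ⟨k, rfl⟩ := Nat.exists_eq_add_of_le' hk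
    obtain ⟨K, -, h⟩ := hσ.exists_real_tdpValue hp t
    obtain ⟨R, hR, -⟩ := h (fun k t => (X k ω t : Euc n)) k
    rw [hR]
    exact ⟨EReal.coe_ne_top _, EReal.coe_ne_bot _⟩
  · have hcluster : ∀ t, ∀ᵐ ω ∂P, ∀ s, MapClusterPt s atTop fun k => X k ω t := fun t =>
      ae_forall_mapClusterPt (fun k => (measurable_pi_apply t).comp (hX k)) (hlaw · t)
        -- Evaluation at a fixed `t` keeps independence in `k`; none is needed between different
        -- times.
        (hindep.comp (fun _ z => z t) fun _ => measurable_pi_apply t)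
    filter_upwards [ae_all_iff.2 hcluster] with ω hω
    have heq := hσ.limit_eq_value hp (fun k t => (X k ω t : Euc n))
      ⟨_, (X 0 ω 0).2⟩ (fun t s hs =>
        (hω t ⟨s, hs⟩).continuousAt_comp continuous_subtype_val.continuousAt) (W ω) (hW ω)
    exact fun t => ⟨fun y _ => heq t y, heq t⟩
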